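/- Let $n\in\mathbb N$ and $0<T<\infty$. A smooth solution of the biharmonic heat equation on $\mathbb R^n\times[0,T]$ means a function $v:\mathbb R^n\times[0,T]\to\mathbb R$ that is $C^\infty$ on $\mathbb R^n\times[0,T]$ (up to and including the times $t=0$ and $t=T$) and satisfies $$\frac{\partial v}{\partial t}=-\Delta^2 v\qquad\text{on }\mathbb R^n\times[0,T],$$ where $\Delta$ is the Laplacian in the space variable, $\Delta^2 v=\Delta(\Delta v)$, and the time derivative is one-sided at $t=0$ and $t=T$. (a) Let $v$ be a smooth solution of the biharmonic heat equation on $\mathbb R^n\times[0,T]$ such that, for some $k_0\in\mathbb R$, $$|\Delta v|^2(x,t)\le\frac{k_0}{t}\qquad\text{for all }x\in\mathbb R^n,\ t\in(0,T],$$ and $v(\cdot,0)\equiv 0$. Then $v\equiv 0$ on $\mathbb R^n\times[0,T]$. (b) Let $u,v$ be smooth solutions of the biharmonic heat equation on $\mathbb R^n\times[0,T]$ such that, for some $k_0\in\mathbb R$, $$|\Delta v|^2(x,t)+|\Delta u|^2(x,t)\le\frac{k_0}{t}\qquad\text{for all }x\in\mathbb R^n,\ t\in(0,T],$$ and $u(\cdot,0)=v(\cdot,0)$.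 Then $u\equiv v$ on $\mathbb R^n\times[0,T]$. -/

import Mathlib

open scoped ContDiff

/-- `u x t` is a smooth solution of the biharmonic heat equation `∂u/∂t = -Δ²u` on `ℝⁿ × [0, T]`:
`u` is jointly smooth (`C^∞`, up to and including the times `0` and `T`), and at every time
`t ∈ [0, T]` the time derivative (one-sided at the end points) is `-Δ(Δ u(·, t))`, where `Δ` is the
Laplacian in the space variable. Only the values of `u` at times in `[0, T]` matter. -/
structure IsSmoothBiharmonicHeatSolution (n : ℕ) (T : ℝ)
    (u : EuclideanSpace ℝ (Fin n) → ℝ → ℝ) : Prop where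
  smooth : ContDiffOn ℝ ∞ (fun p : EuclideanSpace ℝ (Fin n) × ℝ => u p.1 p.2)
    (Set.univ ×ˢ Set.Icc 0 T)
  equation : ∀ x : EuclideanSpace ℝ (Fin n), ∀ t ∈ Set.Icc 0 T,
    HasDerivWithinAt (fun s => u x s)
      (-(Laplacian.laplacian (Laplacian.laplacian (fun y => u y t)) x)) (Set.Icc 0 T) t

/-! The difference of two solutions is a solution whose Laplacian obeys the same kind of bound, so
uniqueness reduces to the vanishing of a solution `v` with zero initial data and
`|Δv| ≤ √(k / t)`. Nothing bounds `v` itself, but the time primitive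
`F(x, t) = ∫₀ᵗ Δv(x, s) ds` is bounded by `2 √k √T`, since `s ↦ s ^ (-1/2)` is integrable at `0`.
It satisfies the system `∂F/∂t = Δv`, `ΔF = ∫₀ᵗ Δ²v = -v`; in particular it is a bounded
solution of the biharmonic heat equation with zero initial data, and `F = 0` gives `v = -ΔF = 0`.

Bounded solutions of the system vanish by a local energy argument
(`eq_zero_of_bounded_of_laplacian_eq`). Let `η_R` be a smooth cutoff at scale `R` and
`E_R(t) = ∫ F² η_R⁴`. Then `E_R' = 2 ∫ F Δv η_R⁴`, and Green's second identity together with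
Young's inequality bounds this by `C R⁻⁴ E_{2R}` (`local_energy_le`): the gradient of `F` is
controlled through `Δ(F²) = 2 |∇F|² + 2 F ΔF`, and every occurrence of `v` is absorbed by the good
term `-∫ v² η_R⁴`. Boundedness of `F` gives `E_R ≤ K R ^ N`, with `N` the dimension. Each use of
`E_R ≤ C T R⁻⁴ sup E_{2R}` gains a negative power of `R`, so that after finitely many steps
`E_R ≤ K / R`. As `E_R ≤ E_S` for `S ≥ 2R`, letting `S → ∞` yields `E_R = 0`.
-/

/-! ### Laplacian, gradient products and Green's identity -/

section Calculus

variable {E : Type*} [NormedAddCommGroup E] [InnerProductSpace ℝ E] [FiniteDimensional ℝ E]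

/-- The carré du champ `Γ(f, g) = ∇f · ∇g`, in coordinates of the standard orthonormal basis. -/
noncomputable def gradDot (f g : E → ℝ) (x : E) : ℝ :=
  ∑ i, fderiv ℝ f x (stdOrthonormalBasis ℝ E i) * fderiv ℝ g x (stdOrthonormalBasis ℝ E i)

/-- The trace of a bilinear form, in the standard orthonormal basis. -/
noncomputable def bilinTrace (E : Type*) [NormedAddCommGroup E] [InnerProductSpace ℝ E]
    [FiniteDimensional ℝ E] : (E →L[ℝ] E →L[ℝ] ℝ) →L[ℝ] ℝ :=
  ∑ i, (ContinuousLinearMap.apply ℝ ℝ (stdOrthonormalBasis ℝ E i)).comp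
    (ContinuousLinearMap.apply ℝ (E →L[ℝ] ℝ) (stdOrthonormalBasis ℝ E i))

lemma laplacian_eq_bilinTrace (f : E → ℝ) (x : E) :
    Laplacian.laplacian f x = bilinTrace E (fderiv ℝ (fderiv ℝ f) x) := by
  rw [InnerProductSpace.laplacian_eq_iteratedFDeriv_stdOrthonormalBasis]
  simp [bilinTrace, iteratedFDeriv_two_apply]

lemma laplacian_eq_sum (f : E → ℝ) (x : E) :
    Laplacian.laplacian f x = ∑ i, fderiv ℝ (fderiv ℝ f) x (stdOrthonormalBasis ℝ E i)
      (stdOrthonormalBasis ℝ E i) := by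
  rw [InnerProductSpace.laplacian_eq_iteratedFDeriv_stdOrthonormalBasis]
  simp [iteratedFDeriv_two_apply]

lemma ContDiff.continuous_laplacian {f : E → ℝ} (hf : ContDiff ℝ 2 f) :
    Continuous (Laplacian.laplacian f) := by
  have h : Continuous (fderiv ℝ (fderiv ℝ f)) :=
    (hf.fderiv_right (m := 1) (by norm_num)).continuous_fderiv (by norm_num)
  rw [show Laplacian.laplacian f = fun x => bilinTrace E (fderiv ℝ (fderiv ℝ f) x) from
    funext (laplacian_eq_bilinTrace f)]
  fun_prop

lemma ContDiff.continuous_gradDot {f g : E → ℝ} (hf : ContDiff ℝ 1 f) (hg : ContDiff ℝ 1 g) :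
    Continuous (gradDot f g) := by
  have h1 := hf.continuous_fderiv (by norm_num)
  have h2 := hg.continuous_fderiv (by norm_num)
  unfold gradDot
  fun_prop

lemma gradDot_comm (f g : E → ℝ) (x : E) : gradDot f g x = gradDot g f x := by
  simp only [gradDot, mul_comm]

lemma gradDot_self_nonneg (f : E → ℝ) (x : E) : 0 ≤ gradDot f f x :=
  Finset.sum_nonneg fun _ _ => mul_self_nonneg _

lemma gradDot_sq_le (f g : E → ℝ) (x : E) :
    gradDot f g x ^ 2 ≤ gradDot f f x * gradDot g g x := by
  have := Finset.sum_mul_sq_le_sq_mul_sq Finset.univ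
    (fun i => fderiv ℝ f x (stdOrthonormalBasis ℝ E i))
    (fun i => fderiv ℝ g x (stdOrthonormalBasis ℝ E i))
  simpa only [gradDot, ← sq] using this

lemma gradDot_mul_right {f g h : E → ℝ} {x : E} (hg : DifferentiableAt ℝ g x)
    (hh : DifferentiableAt ℝ h x) :
    gradDot f (fun y => g y * h y) x = g x * gradDot f h x + h x * gradDot f g x := by
  simp only [gradDot, fderiv_fun_mul hg hh, Finset.mul_sum, ← Finset.sum_add_distrib]
  refine Finset.sum_congr rfl fun i _ => ?_
  simp
  ring

lemma laplacian_fun_mul {f g : E → ℝ} (hf : ContDiff ℝ 2 f) (hg : ContDiff ℝ 2 g) (x : E) :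
    Laplacian.laplacian (fun y => f y * g y) x =
      f x * Laplacian.laplacian g x + 2 * gradDot f g x + g x * Laplacian.laplacian f x := by
  have hf1 := hf.differentiable (by norm_num)
  have hg1 := hg.differentiable (by norm_num)
  have hf2 := (hf.fderiv_right (m := 1) (by norm_num)).differentiable (by norm_num)
  have hg2 := (hg.fderiv_right (m := 1) (by norm_num)).differentiable (by norm_num)
  have h1 : fderiv ℝ (fun y => f y * g y) = fun y => f y • fderiv ℝ g y + g y • fderiv ℝ f y :=
    funext fun y => fderiv_fun_mul (hf1 y) (hg1 y)
  simp only [laplacian_eq_sum, gradDot, Finset.mul_sum, ← Finset.sum_add_distrib, h1]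
  refine Finset.sum_congr rfl fun i _ => ?_
  rw [fderiv_fun_add ((hf1 x).fun_smul (hg2 x)) ((hg1 x).fun_smul (hf2 x)),
    fderiv_fun_smul (hf1 x) (hg2 x), fderiv_fun_smul (hg1 x) (hf2 x)]
  simp
  ring

lemma gradDot_eq_zero_of_notMem_tsupport {g : E → ℝ} {x : E} (hx : x ∉ tsupport g)
    (f : E → ℝ) : gradDot f g x = 0 := by
  have : fderiv ℝ g x = 0 := image_eq_zero_of_notMem_tsupport
    (fun h => hx (tsupport_fderiv_subset ℝ h))
  simp [gradDot, this]

lemma laplacian_eq_zero_of_notMem_tsupport {g : E → ℝ} {x : E} (hx : x ∉ tsupport g) :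
    Laplacian.laplacian g x = 0 := by
  have : fderiv ℝ (fderiv ℝ g) x = 0 := image_eq_zero_of_notMem_tsupport
    (fun h => hx (tsupport_fderiv_subset ℝ (tsupport_fderiv_subset ℝ h)))
  simp [laplacian_eq_sum, this]

lemma HasCompactSupport.laplacian {f : E → ℝ} (hf : HasCompactSupport f) :
    HasCompactSupport (Laplacian.laplacian f) :=
  HasCompactSupport.intro hf fun _ hx => laplacian_eq_zero_of_notMem_tsupport hx

lemma HasCompactSupport.gradDot {g : E → ℝ} (hg : HasCompactSupport g) (f : E → ℝ) :
    HasCompactSupport (gradDot f g) :=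
  HasCompactSupport.intro hg fun _ hx => gradDot_eq_zero_of_notMem_tsupport hx f

lemma gradDot_comp_smul {f : E → ℝ} (c : ℝ) (x : E) :
    gradDot (fun y => f (c • y)) (fun y => f (c • y)) x = c ^ 2 * gradDot f f (c • x) := by
  simp only [gradDot, Finset.mul_sum, fderiv_comp_smul]
  refine Finset.sum_congr rfl fun i _ => ?_
  simp
  ring

lemma laplacian_comp_smul {f : E → ℝ} (hf : ContDiff ℝ 2 f) (c : ℝ) (x : E) :
    Laplacian.laplacian (fun y => f (c • y)) x = c ^ 2 * Laplacian.laplacian f (c • x) := by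
  have h1 : fderiv ℝ (fun y => f (c • y)) = fun y => c • fderiv ℝ f (c • y) :=
    funext fun y => by rw [fderiv_comp_smul]
  have h2 : Differentiable ℝ (fderiv ℝ f) :=
    (hf.fderiv_right (m := 1) (by norm_num)).differentiable (by norm_num)
  have h3 : Differentiable ℝ (fun y => fderiv ℝ f (c • y)) := h2.comp (by fun_prop)
  simp only [laplacian_eq_sum, h1, Finset.mul_sum]
  refine Finset.sum_congr rfl fun i _ => ?_
  rw [fderiv_fun_const_smul (h3 x), fderiv_comp_smul]
  simp
  ring

variable [MeasurableSpace E] [BorelSpace E] {μ : MeasureTheory.Measure E}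
  [μ.IsAddHaarMeasure]

open MeasureTheory

/-- One integration by parts: `∫ f Δg = -∫ ∇f · ∇g` if one of the factors has compact support. -/
lemma integral_mul_laplacian_eq_neg_gradDot {f g : E → ℝ} (hf : ContDiff ℝ 1 f)
    (hg : ContDiff ℝ 2 g) (hc : HasCompactSupport f ∨ HasCompactSupport g) :
    ∫ x, f x * Laplacian.laplacian g x ∂μ = -∫ x, gradDot f g x ∂μ := by
  have hf0 := hf.continuous
  have hf1 := hf.continuous_fderiv (by norm_num)
  have hg1 := hg.fderiv_right (m := 1) (by norm_num)
  have hg1c := hg1.continuous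
  have hg2 := hg1.continuous_fderiv (by norm_num)
  obtain ⟨K, hK, hK0⟩ : ∃ K : Set E, IsCompact K ∧ ∀ x ∉ K, (f x = 0 ∧ fderiv ℝ f x = 0) ∨
      (fderiv ℝ g x = 0 ∧ fderiv ℝ (fderiv ℝ g) x = 0) := by
    rcases hc with hc | hc
    · exact ⟨_, hc, fun x hx => Or.inl ⟨image_eq_zero_of_notMem_tsupport hx,
        image_eq_zero_of_notMem_tsupport fun h => hx (tsupport_fderiv_subset ℝ h)⟩⟩
    · exact ⟨_, hc, fun x hx => Or.inr ⟨image_eq_zero_of_notMem_tsupport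
        fun h => hx (tsupport_fderiv_subset ℝ h), image_eq_zero_of_notMem_tsupport
        fun h => hx (tsupport_fderiv_subset ℝ (tsupport_fderiv_subset ℝ h))⟩⟩
  have hi1 : ∀ v, Integrable (fun x => fderiv ℝ f x v * fderiv ℝ g x v) μ := fun v =>
    Continuous.integrable_of_hasCompactSupport (by fun_prop)
      (HasCompactSupport.intro hK fun x hx => by rcases hK0 x hx with h | h <;> simp [h])
  have hi2 : ∀ v, Integrable (fun x => f x * fderiv ℝ (fderiv ℝ g) x v v) μ := fun v =>
    Continuous.integrable_of_hasCompactSupport (by fun_prop)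
      (HasCompactSupport.intro hK fun x hx => by rcases hK0 x hx with h | h <;> simp [h])
  have hi3 : ∀ v, Integrable (fun x => f x * fderiv ℝ g x v) μ := fun v =>
    Continuous.integrable_of_hasCompactSupport (by fun_prop)
      (HasCompactSupport.intro hK fun x hx => by rcases hK0 x hx with h | h <;> simp [h])
  have key : ∀ v : E, ∫ x, f x * fderiv ℝ (fderiv ℝ g) x v v ∂μ =
      -∫ x, fderiv ℝ f x v * fderiv ℝ g x v ∂μ := by
    intro v
    have hd : ∀ x, fderiv ℝ (fun y => fderiv ℝ g y v) x v = fderiv ℝ (fderiv ℝ g) x v v := by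
      intro x
      rw [fderiv_clm_apply (hg1.differentiable (by norm_num) x) (by fun_prop)]
      simp
    have := integral_mul_fderiv_eq_neg_fderiv_mul_of_integrable (μ := μ) (f := f)
      (g := fun y => fderiv ℝ g y v) (v := v) (hi1 v) (by simpa only [hd] using hi2 v) (hi3 v)
      (fun x _ => hf.differentiable (by norm_num) x)
      (fun x _ => (hg1.differentiable (by norm_num) x).clm_apply (by fun_prop))
    simpa only [hd] using this
  simp only [laplacian_eq_sum, gradDot, Finset.mul_sum]
  rw [integral_finsetSum _ fun i _ => hi2 _, integral_finsetSum _ fun i _ => hi1 _,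
    ← Finset.sum_neg_distrib]
  exact Finset.sum_congr rfl fun i _ => key _

/-- **Green's second identity** without boundary terms. -/
theorem integral_mul_laplacian_comm {f g : E → ℝ} (hf : ContDiff ℝ 2 f) (hg : ContDiff ℝ 2 g)
    (hfc : HasCompactSupport f) :
    ∫ x, f x * Laplacian.laplacian g x ∂μ = ∫ x, g x * Laplacian.laplacian f x ∂μ := by
  rw [integral_mul_laplacian_eq_neg_gradDot (hf.of_le (by norm_num)) hg (.inl hfc),
    integral_mul_laplacian_eq_neg_gradDot (hg.of_le (by norm_num)) hf (.inr hfc)]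
  simp only [gradDot_comm f g]

end Calculus

/-! ### Local energy estimates -/

section Growth

open MeasureTheory Metric Set

variable {E : Type*} [NormedAddCommGroup E] [MeasurableSpace E] [BorelSpace E] {μ : Measure E}
  [IsFiniteMeasureOnCompacts μ]

/-- Growth of a weighted energy: if `F` vanishes at time `0` and has time derivative `f`, an upper
bound `A` on `∫ F f φ`, half the time derivative of `∫ F² φ`, gives `∫ F² φ ≤ 2 A t`. The weight has
compact support, so no decay of `F` and `f` is needed. -/
lemma integral_sq_mul_le_of_integral_mul_le {F f : E → ℝ → ℝ} {φ : E → ℝ} {T A : ℝ}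
    (hF : Continuous fun p : E × ℝ => F p.1 p.2) (hf : Continuous fun p : E × ℝ => f p.1 p.2)
    (hderiv : ∀ x t, HasDerivAt (F x) (f x t) t) (hF0 : ∀ x, F x 0 = 0) (hφ : Continuous φ)
    (hφc : HasCompactSupport φ) (hA : ∀ t ∈ Icc 0 T, ∫ x, F x t * f x t * φ x ∂μ ≤ A) :
    ∀ t ∈ Icc 0 T, ∫ x, F x t ^ 2 * φ x ∂μ ≤ 2 * A * t := by
  have hFx : ∀ t, Continuous fun x => F x t := fun t =>
    hF.comp (continuous_id.prodMk continuous_const)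
  have hfx : ∀ t, Continuous fun x => f x t := fun t =>
    hf.comp (continuous_id.prodMk continuous_const)
  have hE : ∀ t, HasDerivAt (fun s => ∫ x, F x s ^ 2 * φ x ∂μ)
      (∫ x, 2 * (F x t * f x t * φ x) ∂μ) t := by
    intro t
    obtain ⟨M, hM⟩ := (hφc.isCompact.prod (isCompact_closedBall t 1)).exists_bound_of_continuousOn
      (f := fun p : E × ℝ => 2 * (F p.1 p.2 * f p.1 p.2)) (by fun_prop)
    refine (hasDerivAt_integral_of_dominated_loc_of_deriv_le (s := ball t 1)
      (F := fun s x => F x s ^ 2 * φ x) (F' := fun s x => 2 * (F x s * f x s * φ x))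
      (bound := fun x => M * |φ x|) (ball_mem_nhds t one_pos) ?_ ?_ ?_ ?_ ?_ ?_).2
    · exact .of_forall fun s => (((hFx s).pow 2).mul hφ).aestronglyMeasurable
    · exact (((hFx t).pow 2).mul hφ).integrable_of_hasCompactSupport hφc.mul_left
    · exact (continuous_const.mul (((hFx t).mul (hfx t)).mul hφ)).aestronglyMeasurable
    · refine .of_forall fun x s hs => ?_
      by_cases hx : x ∈ tsupport φ
      · have := hM (x, s) ⟨hx, ball_subset_closedBall hs⟩
        calc ‖2 * (F x s * f x s * φ x)‖ = ‖2 * (F x s * f x s)‖ * |φ x| := by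
              rw [← Real.norm_eq_abs, ← norm_mul]; ring_nf
          _ ≤ M * |φ x| := by gcongr
      · simp [image_eq_zero_of_notMem_tsupport hx]
    · exact (continuous_const.mul hφ.abs).integrable_of_hasCompactSupport hφc.abs.mul_left
    · refine .of_forall fun x s _ => ?_
      convert! ((hderiv x s).pow 2).mul_const (φ x) using 1
      simp
      ring
  intro t ht
  have := (convex_Icc (0 : ℝ) T).image_sub_le_mul_sub_of_deriv_le (C := 2 * A)
    (fun s _ => (hE s).continuousAt.continuousWithinAt)
    (fun s _ => (hE s).differentiableAt.differentiableWithinAt)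
    (fun s hs => by
      rw [(hE s).deriv, integral_const_mul]
      linarith [hA s (interior_subset hs)])
    0 ⟨le_rfl, ht.1.trans ht.2⟩ t ht ht.1
  simpa [hF0] using this

end Growth

section Energy

open MeasureTheory Metric Set

variable {E : Type*} [NormedAddCommGroup E] [InnerProductSpace ℝ E] [FiniteDimensional ℝ E]
  [MeasurableSpace E] [BorelSpace E] {μ : Measure E} [μ.IsAddHaarMeasure]

/-- The local energy estimate at a fixed time, for `ΔF = -w`. With `φ = η⁴`, Green's identity turns
the left side into `∫ w Δ(F φ) = ∫ (-w² η⁴ + 2 w ∇F · ∇φ + w F Δφ)`. The middle term needs a bound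
on `∫ η² |∇F|²`, which comes from testing `Δ(F²) = 2 |∇F|² - 2 F w` against `η²`. For a cutoff at
scale `R` the constant `c` is of order `R⁻²`. -/
theorem local_energy_le {F w η χ : E → ℝ} {c : ℝ} (hF : ContDiff ℝ 2 F) (hw : ContDiff ℝ 2 w)
    (hη : ContDiff ℝ 2 η) (hηc : HasCompactSupport η) (hχ : Continuous χ)
    (hχc : HasCompactSupport χ) (hFw : ∀ x, Laplacian.laplacian F x = -w x)
    (hη0 : ∀ x, 0 ≤ η x) (hη1 : ∀ x, η x ≤ 1) (hχ0 : ∀ x, 0 ≤ χ x)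
    (hχ1 : ∀ x ∈ tsupport η, 1 ≤ χ x) (hgrad : ∀ x, gradDot η η x ≤ c)
    (hlap : ∀ x, |Laplacian.laplacian η x| ≤ c) :
    ∫ x, F x * Laplacian.laplacian w x * η x ^ 4 ∂μ ≤
      1344 * c ^ 2 * ∫ x, F x ^ 2 * χ x ∂μ := by
  have d1 : ∀ {g : E → ℝ}, ContDiff ℝ 2 g → Differentiable ℝ g :=
    fun h => h.differentiable (by norm_num)
  set ψ : E → ℝ := fun y => η y * η y with hψdef
  set φ : E → ℝ := fun y => ψ y * ψ y with hφdef
  have hψ : ContDiff ℝ 2 ψ := hη.mul hη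
  have hφ : ContDiff ℝ 2 φ := hψ.mul hψ
  have hψc : HasCompactSupport ψ := hηc.mul_right
  have hφc : HasCompactSupport φ := hψc.mul_right
  have hFφ : ContDiff ℝ 2 (fun y => F y * φ y) := hF.mul hφ
  have hFφc : HasCompactSupport (fun y => F y * φ y) := hφc.mul_left
  have hFF : ContDiff ℝ 2 (fun y => F y * F y) := hF.mul hF
  have id1 : ∫ x, F x * Laplacian.laplacian w x * η x ^ 4 ∂μ =
      ∫ x, w x * Laplacian.laplacian (fun y => F y * φ y) x ∂μ := by
    rw [← integral_mul_laplacian_comm hFφ hw hFφc]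
    congr 1
    ext x
    simp only [hφdef, hψdef]
    ring
  have id2 : ∫ x, ψ x * Laplacian.laplacian (fun y => F y * F y) x ∂μ =
      ∫ x, (F x * F x) * Laplacian.laplacian ψ x ∂μ := integral_mul_laplacian_comm hψ hFF hψc
  have cF := hF.continuous
  have i1 : Integrable (fun x => w x * Laplacian.laplacian (fun y => F y * φ y) x) μ :=
    (hw.continuous.mul hFφ.continuous_laplacian).integrable_of_hasCompactSupport
      hFφc.laplacian.mul_left
  have i2 : Integrable (fun x => ψ x * Laplacian.laplacian (fun y => F y * F y) x) μ :=
    (hψ.continuous.mul hFF.continuous_laplacian).integrable_of_hasCompactSupport hψc.mul_right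
  have i3 : Integrable (fun x => (F x * F x) * Laplacian.laplacian ψ x) μ :=
    (hFF.continuous.mul hψ.continuous_laplacian).integrable_of_hasCompactSupport
      hψc.laplacian.mul_left
  have i4 : Integrable (fun x => F x ^ 2 * χ x) μ :=
    Continuous.integrable_of_hasCompactSupport (by fun_prop) hχc.mul_left
  calc ∫ x, F x * Laplacian.laplacian w x * η x ^ 4 ∂μ
      = ∫ x, (w x * Laplacian.laplacian (fun y => F y * φ y) x -
          16 * c * (ψ x * Laplacian.laplacian (fun y => F y * F y) x -
            (F x * F x) * Laplacian.laplacian ψ x)) ∂μ := by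
        have i5 : Integrable (fun x => 16 * c * (ψ x *
            Laplacian.laplacian (fun y => F y * F y) x - (F x * F x) * Laplacian.laplacian ψ x)) μ :=
          (i2.sub i3).const_mul _
        -- the bracket integrates to zero by `id2`; it serves to cancel the term `η² |∇F|²` below
        rw [integral_sub i1 i5, integral_const_mul, integral_sub i2 i3, id2,
          id1]
        ring
    _ ≤ ∫ x, 1344 * c ^ 2 * (F x ^ 2 * χ x) ∂μ := by
        refine integral_mono (i1.sub ((i2.sub i3).const_mul _)) (i4.const_mul _) fun x => ?_
        have e1 : gradDot F φ x = 4 * η x ^ 3 * gradDot F η x := by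
          rw [hφdef, gradDot_mul_right (d1 hψ x) (d1 hψ x), hψdef,
            gradDot_mul_right (d1 hη x) (d1 hη x)]
          ring
        have e2 : gradDot ψ ψ x = 4 * η x ^ 2 * gradDot η η x := by
          have : gradDot ψ ψ x = 2 * η x * gradDot ψ η x := by
            conv_lhs => rw [hψdef, gradDot_mul_right (d1 hη x) (d1 hη x)]
            ring
          rw [this, gradDot_comm, hψdef, gradDot_mul_right (d1 hη x) (d1 hη x)]
          ring
        have e3 : Laplacian.laplacian ψ x =
            2 * η x * Laplacian.laplacian η x + 2 * gradDot η η x := by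
          rw [hψdef, laplacian_fun_mul hη hη]
          ring
        have e4 : Laplacian.laplacian φ x =
            η x ^ 2 * (4 * η x * Laplacian.laplacian η x + 12 * gradDot η η x) := by
          rw [hφdef, laplacian_fun_mul hψ hψ, e2, e3]
          simp only [hψdef]
          ring
        have h0 : (φ x) = η x ^ 4 := by simp only [hφdef, hψdef]; ring
        beta_reduce
        rw [laplacian_fun_mul hF hφ, laplacian_fun_mul hF hF, hFw, e1, e3, e4, h0]
        simp only [hψdef]
        by_cases hx : x ∈ tsupport η
        · have hP := gradDot_sq_le F η x
          have hQ := gradDot_self_nonneg F x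
          have hg0 := gradDot_self_nonneg η x
          have hg := hgrad x
          have hL := abs_le.1 (hlap x)
          have a0 := hη0 x
          have a1 := hη1 x
          have hX := hχ1 x hx
          generalize gradDot F η x = P at *
          generalize gradDot F F x = Q at *
          generalize gradDot η η x = g at *
          generalize Laplacian.laplacian η x = L at *
          generalize η x = a at *
          generalize F x = f at *
          generalize w x = W at *
          generalize χ x = X at *
          have hc : 0 ≤ c := hg0.trans hg
          have haL : |a * L| ≤ c := by
            rw [abs_mul, abs_of_nonneg a0]
            nlinarith [abs_le.2 hL, abs_nonneg L]
          have haL' := abs_le.1 haL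
          have hm : (4 * a * L + 12 * g) ^ 2 ≤ 256 * c ^ 2 := by
            have : |4 * a * L + 12 * g| ≤ 16 * c := abs_le.2 ⟨by linarith, by linarith⟩
            have := pow_le_pow_left₀ (abs_nonneg _) this 2
            rw [sq_abs] at this
            linarith
          generalize 4 * a * L + 12 * g = m at *
          have hPQ : P ^ 2 ≤ c * Q := hP.trans (by nlinarith)
          -- Young's inequality for each term containing `W`: the coefficients `1/2`, `1/4`, `1/4`
          -- of `W² a⁴` add up to exactly the available `-W² a⁴`
          have y1 : 8 * W * a ^ 3 * P ≤ W ^ 2 * a ^ 4 / 2 + 32 * a ^ 2 * P ^ 2 := by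
            nlinarith [sq_nonneg (W * a ^ 2 - 8 * a * P)]
          have y1' : 32 * a ^ 2 * P ^ 2 ≤ 32 * a ^ 2 * (c * Q) := by gcongr
          have y2 : W * f * a ^ 2 * m ≤ W ^ 2 * a ^ 4 / 4 + f ^ 2 * m ^ 2 := by
            nlinarith [sq_nonneg (W * a ^ 2 / 2 - f * m)]
          have y2' : f ^ 2 * m ^ 2 ≤ f ^ 2 * (256 * c ^ 2) := by gcongr
          have y3 : 32 * c * a ^ 2 * f * W ≤ W ^ 2 * a ^ 4 / 4 + 1024 * c ^ 2 * f ^ 2 := by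
            nlinarith [sq_nonneg (W * a ^ 2 / 2 - 32 * c * f)]
          have y4 : 16 * c * f ^ 2 * (2 * (a * L) + 2 * g) ≤ 16 * c * f ^ 2 * (4 * c) := by
            gcongr
            linarith
          have y5 : 1344 * c ^ 2 * f ^ 2 * 1 ≤ 1344 * c ^ 2 * f ^ 2 * X := by gcongr
          linarith
        · have a0 : η x = 0 := image_eq_zero_of_notMem_tsupport hx
          rw [a0, gradDot_eq_zero_of_notMem_tsupport hx]
          have := hχ0 x
          simp
          positivity
    _ = 1344 * c ^ 2 * ∫ x, F x ^ 2 * χ x ∂μ := integral_const_mul _ _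

end Energy

/-! ### Cutoff functions -/

section Cutoff

open Metric Set

variable {E : Type*} [NormedAddCommGroup E] [InnerProductSpace ℝ E] [FiniteDimensional ℝ E]

/-- A fixed smooth bump function: `1` on the unit ball, supported in the ball of radius `2`. -/
noncomputable def unitBump (E : Type*) [NormedAddCommGroup E] [InnerProductSpace ℝ E] :
    ContDiffBump (0 : E) :=
  ⟨1, 2, one_pos, one_lt_two⟩

/-- The cutoff at scale `R`: it is `1` on the ball of radius `R` and supported in the ball of
radius `2 * R`. -/
noncomputable def cutoff (R : ℝ) (x : E) : ℝ := unitBump E (R⁻¹ • x)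

lemma contDiff_cutoff (R : ℝ) : ContDiff ℝ 2 (cutoff R : E → ℝ) :=
  (unitBump E).contDiff.comp (contDiff_const_smul _)

lemma cutoff_nonneg (R : ℝ) (x : E) : 0 ≤ cutoff R x := (unitBump E).nonneg

lemma cutoff_le_one (R : ℝ) (x : E) : cutoff R x ≤ 1 := (unitBump E).le_one

lemma cutoff_eq_one {R : ℝ} (hR : 0 < R) {x : E} (hx : ‖x‖ ≤ R) : cutoff R x = 1 := by
  refine (unitBump E).one_of_mem_closedBall ?_
  simp only [mem_closedBall_zero_iff, norm_smul, norm_inv, Real.norm_eq_abs, abs_of_pos hR,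
    unitBump]
  rw [inv_mul_le_iff₀ hR]
  linarith

lemma tsupport_cutoff_subset {R : ℝ} (hR : 0 < R) :
    tsupport (cutoff R : E → ℝ) ⊆ closedBall 0 (2 * R) := by
  refine closure_minimal (fun x hx => ?_) isClosed_closedBall
  have h : R⁻¹ • x ∈ Function.support (unitBump E) := hx
  rw [(unitBump E).support_eq, mem_ball_zero_iff, norm_smul, norm_inv, Real.norm_eq_abs,
    abs_of_pos hR, inv_mul_lt_iff₀ hR] at h
  rw [mem_closedBall_zero_iff]
  simp only [unitBump] at h
  linarith

lemma hasCompactSupport_cutoff {R : ℝ} (hR : 0 < R) : HasCompactSupport (cutoff R : E → ℝ) :=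
  (isCompact_closedBall _ _).of_isClosed_subset (isClosed_tsupport _) (tsupport_cutoff_subset hR)

lemma cutoff_eq_one_of_mem_tsupport {R S : ℝ} (hR : 0 < R) (hS : 2 * R ≤ S) {x : E}
    (hx : x ∈ tsupport (cutoff R : E → ℝ)) : cutoff S x = 1 :=
  cutoff_eq_one (by linarith)
    ((mem_closedBall_zero_iff.1 (tsupport_cutoff_subset hR hx)).trans hS)

lemma exists_cutoff_bounds (E : Type*) [NormedAddCommGroup E] [InnerProductSpace ℝ E]
    [FiniteDimensional ℝ E] : ∃ c : ℝ, ∀ R : ℝ, ∀ x : E,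
      gradDot (cutoff R) (cutoff R) x ≤ c / R ^ 2 ∧
      |Laplacian.laplacian (cutoff R : E → ℝ) x| ≤ c / R ^ 2 := by
  have h : ContDiff ℝ 2 (unitBump E) := (unitBump E).contDiff
  have hc : HasCompactSupport (unitBump E) := (unitBump E).hasCompactSupport
  obtain ⟨c₁, h₁⟩ := ((h.of_le (by norm_num)).continuous_gradDot
    (h.of_le (by norm_num))).bounded_above_of_compact_support (hc.gradDot _)
  obtain ⟨c₂, h₂⟩ := h.continuous_laplacian.bounded_above_of_compact_support hc.laplacian
  refine ⟨max c₁ c₂, fun R x => ⟨?_, ?_⟩⟩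
  · have : gradDot (cutoff R) (cutoff R) x = _ := gradDot_comp_smul (f := unitBump E) R⁻¹ x
    rw [this, inv_pow, div_eq_inv_mul]
    gcongr
    exact (le_abs_self _).trans ((h₁ _).trans (le_max_left _ _))
  · have : Laplacian.laplacian (cutoff R : E → ℝ) x = _ := laplacian_comp_smul h R⁻¹ x
    rw [this, inv_pow, div_eq_inv_mul, abs_mul, abs_of_nonneg (by positivity : 0 ≤ (R ^ 2)⁻¹)]
    gcongr
    exact (h₂ _).trans (le_max_right _ _)

end Cutoff

/-! ### Uniqueness for the system `∂F/∂t = Δw`, `ΔF = -w` -/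

section Uniqueness

open MeasureTheory Metric Set Module

variable {E : Type*} [NormedAddCommGroup E] [InnerProductSpace ℝ E] [FiniteDimensional ℝ E]

/-- Bounded solutions of `∂F/∂t = f = Δw`, `ΔF = -w` with `F = 0` at time `0` vanish on `[0, T]`.
The derivative in time is assumed at all real times, which avoids one-sided derivatives; the two
equations in space are only needed on `[0, T]`. -/
theorem eq_zero_of_bounded_of_laplacian_eq {F f w : E → ℝ → ℝ} {T B : ℝ}
    (hF : Continuous fun p : E × ℝ => F p.1 p.2) (hf : Continuous fun p : E × ℝ => f p.1 p.2)
    (hderiv : ∀ x t, HasDerivAt (F x) (f x t) t) (hF0 : ∀ x, F x 0 = 0)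
    (hB : ∀ t ∈ Icc 0 T, ∀ x, |F x t| ≤ B)
    (hF2 : ∀ t ∈ Icc 0 T, ContDiff ℝ 2 fun x => F x t)
    (hw2 : ∀ t ∈ Icc 0 T, ContDiff ℝ 2 fun x => w x t)
    (hFw : ∀ t ∈ Icc 0 T, ∀ x, Laplacian.laplacian (fun y => F y t) x = -w x t)
    (hwf : ∀ t ∈ Icc 0 T, ∀ x, Laplacian.laplacian (fun y => w y t) x = f x t) :
    ∀ t ∈ Icc 0 T, ∀ x, F x t = 0 := by
  borelize E
  let μ : Measure E := Measure.addHaar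
  set N := finrank ℝ E
  have hFx : ∀ t, Continuous fun x => F x t := fun t =>
    hF.comp (continuous_id.prodMk continuous_const)
  have hηc : ∀ R, Continuous (cutoff R : E → ℝ) := fun R => (contDiff_cutoff R).continuous
  have hη4c : ∀ {R : ℝ}, 0 < R → HasCompactSupport fun x : E => cutoff R x ^ 4 := fun hR =>
    (hasCompactSupport_cutoff hR).comp_left (g := fun a : ℝ => a ^ 4) (by norm_num)
  have hint : ∀ {R : ℝ} (t : ℝ), 0 < R → Integrable (fun x => F x t ^ 2 * cutoff R x ^ 4) μ :=
    fun t hR => (((hFx t).pow 2).mul ((hηc _).pow 4)).integrable_of_hasCompactSupport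
      (hη4c hR).mul_left
  obtain ⟨c, hc⟩ := exists_cutoff_bounds E
  have hstep : ∀ R : ℝ, 0 < R → ∀ A : ℝ,
      (∀ t ∈ Icc 0 T, ∫ x, F x t ^ 2 * cutoff (2 * R) x ^ 4 ∂μ ≤ A) →
      ∀ t ∈ Icc 0 T, ∫ x, F x t ^ 2 * cutoff R x ^ 4 ∂μ ≤
        2 * (1344 * (c / R ^ 2) ^ 2 * A) * t := by
    intro R hR A hA
    refine integral_sq_mul_le_of_integral_mul_le hF hf hderiv hF0 ((hηc R).pow 4) (hη4c hR) ?_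
    intro t ht
    have := local_energy_le (μ := μ) (χ := fun x => cutoff (2 * R) x ^ 4) (hF2 t ht) (hw2 t ht)
      (contDiff_cutoff R) (hasCompactSupport_cutoff hR) ((hηc _).pow 4) (hη4c (by positivity))
      (hFw t ht) (cutoff_nonneg R) (cutoff_le_one R) (fun x => by positivity)
      (fun x hx => by simp [cutoff_eq_one_of_mem_tsupport hR le_rfl hx])
      (fun x => (hc R x).1) (fun x => (hc R x).2)
    simp only [hwf t ht] at this
    exact this.trans (by gcongr; exact hA t ht)
  -- every step gains a factor `R⁻⁴`, of which `R⁻¹` suffices since `1 ≤ R`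
  have hiter : ∀ j : ℕ, ∃ K : ℝ, ∀ R : ℝ, 1 ≤ R → ∀ t ∈ Icc 0 T,
      R ^ j * ∫ x, F x t ^ 2 * cutoff R x ^ 4 ∂μ ≤ K * R ^ N := by
    intro j
    induction j with
    | zero =>
      refine ⟨B ^ 2 * ∫ x, unitBump E x ^ 4 ∂μ, fun R hR t ht => ?_⟩
      have hR0 : 0 < R := by linarith
      have h1 : ∫ x : E, cutoff R x ^ 4 ∂μ = R ^ N * ∫ x, unitBump E x ^ 4 ∂μ := by
        have := Measure.integral_comp_inv_smul μ (fun x : E => unitBump E x ^ 4) R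
        rw [abs_of_pos (by positivity)] at this
        exact this
      calc R ^ 0 * ∫ x, F x t ^ 2 * cutoff R x ^ 4 ∂μ
          = ∫ x, F x t ^ 2 * cutoff R x ^ 4 ∂μ := by simp
        _ ≤ ∫ x, B ^ 2 * cutoff R x ^ 4 ∂μ := by
            refine integral_mono (hint t hR0) ((((hηc R).pow 4).integrable_of_hasCompactSupport
              (hη4c hR0)).const_mul _) fun x => ?_
            have := hB t ht x
            have : F x t ^ 2 ≤ B ^ 2 := sq_le_sq' (abs_le.1 this).1 (abs_le.1 this).2
            beta_reduce
            gcongr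
        _ = _ := by rw [integral_const_mul, h1]; ring
    | succ j ih =>
      obtain ⟨K, hK⟩ := ih
      refine ⟨2 * 1344 * c ^ 2 * K * 2 ^ N * T, fun R hR t ht => ?_⟩
      have hR0 : 0 < R := by linarith
      have h2R : (0 : ℝ) < (2 * R) ^ j := by positivity
      have h1 := hstep R hR0 (K * (2 * R) ^ N / (2 * R) ^ j)
        (fun s hs => by
          rw [le_div_iff₀ h2R, mul_comm]
          exact hK (2 * R) (by linarith) s hs) t ht
      have hT : 0 ≤ T := ht.1.trans ht.2
      have hK0 : 0 ≤ K := by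
        have h := hK 1 le_rfl 0 ⟨le_rfl, hT⟩
        simpa [hF0] using h
      calc R ^ (j + 1) * ∫ x, F x t ^ 2 * cutoff R x ^ 4 ∂μ
          ≤ R ^ (j + 1) * (2 * (1344 * (c / R ^ 2) ^ 2 * (K * (2 * R) ^ N / (2 * R) ^ j)) * t) := by
            gcongr
        _ = 2 * 1344 * c ^ 2 * K * 2 ^ N * t * R ^ N * (1 / (R ^ 3 * 2 ^ j)) := by
            rw [mul_pow 2 R j, mul_pow 2 R N]
            field_simp
            ring
        _ ≤ 2 * 1344 * c ^ 2 * K * 2 ^ N * T * R ^ N * 1 := by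
            have h2 : 1 / (R ^ 3 * 2 ^ j) ≤ 1 := by
              rw [div_le_one (by positivity)]
              exact one_le_mul_of_one_le_of_one_le (one_le_pow₀ hR) (one_le_pow₀ one_le_two)
            gcongr
            exact ht.2
        _ = _ := by ring
  obtain ⟨K, hK⟩ := hiter (N + 1)
  intro t ht x
  set R := max 1 ‖x‖
  have hR1 : 1 ≤ R := le_max_left _ _
  have hR0 : 0 < R := by linarith
  have hle : ∀ S : ℝ, 2 * R ≤ S → ∫ x, F x t ^ 2 * cutoff R x ^ 4 ∂μ ≤ K / S := by
    intro S hS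
    have hS0 : 0 < S := by linarith
    have h1 := hK S (by linarith) t ht
    have h2 : ∫ x, F x t ^ 2 * cutoff R x ^ 4 ∂μ ≤ ∫ x, F x t ^ 2 * cutoff S x ^ 4 ∂μ := by
      refine integral_mono (hint t hR0) (hint t hS0) fun y => ?_
      by_cases hy : y ∈ tsupport (cutoff R : E → ℝ)
      · have h3 := cutoff_eq_one_of_mem_tsupport hR0 hS hy
        have h4 := cutoff_nonneg R y
        have h5 := cutoff_le_one R y
        beta_reduce
        rw [h3]
        gcongr
      · have : cutoff R y = 0 := image_eq_zero_of_notMem_tsupport hy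
        have := cutoff_nonneg S y
        beta_reduce
        rw [‹cutoff R y = 0›, zero_pow (by norm_num), mul_zero]
        positivity
    rw [le_div_iff₀ hS0]
    rw [pow_succ, mul_assoc, mul_comm K] at h1
    have := le_of_mul_le_mul_left h1 (by positivity)
    nlinarith
  have hle0 : ∫ x, F x t ^ 2 * cutoff R x ^ 4 ∂μ ≤ 0 :=
    ge_of_tendsto (Filter.Tendsto.const_div_atTop Filter.tendsto_id K)
      ((Filter.eventually_ge_atTop (2 * R)).mono hle)
  by_contra hne
  refine hle0.not_gt ((((hFx t).pow 2).mul
    ((hηc R).pow 4)).integral_pos_of_hasCompactSupport_nonneg_nonzero (hη4c hR0).mul_left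
    (fun y => by have := cutoff_nonneg R y; positivity) (x := x) ?_)
  simp [cutoff_eq_one hR0 (le_max_right 1 ‖x‖), R, hne]

end Uniqueness

/-! ### Space derivatives of time slices and of time primitives -/

section Slices

open MeasureTheory Metric Set

variable {E G : Type*} [NormedAddCommGroup E] [NormedSpace ℝ E] [NormedAddCommGroup G]
  [NormedSpace ℝ G]

lemma ContDiffOn.contDiff_two_slice {V : E × ℝ → G} {I : Set ℝ} {t : ℝ}
    (hV : ContDiffOn ℝ ∞ V (univ ×ˢ I)) (ht : t ∈ I) : ContDiff ℝ 2 fun y => V (y, t) :=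
  (contDiffOn_infty.1 hV 2).comp_contDiff
    (contDiff_id.prodMk contDiff_const) fun _ => ⟨mem_univ _, ht⟩

/-- The space derivative of a function smooth up to the boundary times is again smooth up to the
boundary times. -/
lemma ContDiffOn.fderiv_slice {V : E × ℝ → G} {I : Set ℝ} (hI : UniqueDiffOn ℝ I)
    (hV : ContDiffOn ℝ ∞ V (univ ×ˢ I)) :
    ContDiffOn ℝ ∞ (fun p : E × ℝ => fderiv ℝ (fun y => V (y, p.2)) p.1) (univ ×ˢ I) := by
  have hS : UniqueDiffOn ℝ ((univ : Set E) ×ˢ I) := uniqueDiffOn_univ.prod hI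
  have h1 : ContDiffOn ℝ ∞ (fun p => (fderivWithin ℝ V (univ ×ˢ I) p).comp
      (ContinuousLinearMap.inl ℝ E ℝ)) (univ ×ˢ I) :=
    (hV.fderivWithin hS (m := ∞) (by simp)).clm_comp contDiffOn_const
  refine h1.congr fun p hp => HasFDerivAt.fderiv ?_
  have h2 : HasFDerivWithinAt V (fderivWithin ℝ V (univ ×ˢ I) p) (univ ×ˢ I) (p.1, p.2) :=
    (hV.differentiableOn (by simp) p hp).hasFDerivWithinAt
  exact hasFDerivWithinAt_univ.1 (h2.comp p.1 (s := univ) (f := fun y => (y, p.2))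
    (hasFDerivAt_prodMk_left p.1 p.2).hasFDerivWithinAt fun _ _ => ⟨mem_univ _, hp.2⟩)

lemma ContinuousOn.comp_projIcc {X Y : Type*} [TopologicalSpace X] [TopologicalSpace Y]
    {V : X × ℝ → Y} {a b : ℝ} (hab : a ≤ b) (hV : ContinuousOn V (univ ×ˢ Icc a b)) :
    Continuous fun p : X × ℝ => V (p.1, (projIcc a b hab p.2 : ℝ)) :=
  hV.comp_continuous (by fun_prop) fun p => ⟨mem_univ _, (projIcc a b hab p.2).2⟩

/-- Freezing the time at the end points of `[0, T]` extends a function smooth on `E × [0, T]` to all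
times. The extension is only continuous in time, but its space derivatives are jointly
continuous. -/
lemma ContDiffOn.exists_continuous_slices {V : E × ℝ → G} {T : ℝ} (hT : 0 < T)
    (hV : ContDiffOn ℝ ∞ V (univ ×ˢ Icc 0 T)) :
    ∃ g : E → ℝ → G, (∀ s ∈ Icc 0 T, ∀ x, g x s = V (x, s)) ∧
      (Continuous fun p : E × ℝ => g p.1 p.2) ∧ (∀ s, ContDiff ℝ 2 fun y => g y s) ∧
      (Continuous fun p : E × ℝ => fderiv ℝ (fun y => g y p.2) p.1) ∧
      Continuous fun p : E × ℝ => fderiv ℝ (fderiv ℝ fun y => g y p.2) p.1 := by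
  have hI := uniqueDiffOn_Icc hT
  have hV' := hV.fderiv_slice hI
  exact ⟨fun x s => V (x, projIcc 0 T hT.le s),
    fun s hs x => by simp only [projIcc_of_mem hT.le hs],
    hV.continuousOn.comp_projIcc hT.le,
    fun s => hV.contDiff_two_slice (projIcc 0 T hT.le s).2,
    hV'.continuousOn.comp_projIcc hT.le,
    (hV'.fderiv_slice hI).continuousOn.comp_projIcc hT.le⟩

/-- Differentiation under an integral over a compact interval. -/
lemma hasFDerivAt_intervalIntegral_of_continuous [ProperSpace E] {g : E → ℝ → G}
    {g' : E → ℝ → E →L[ℝ] G} (hg : Continuous fun p : E × ℝ => g p.1 p.2)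
    (hg' : Continuous fun p : E × ℝ => g' p.1 p.2)
    (hd : ∀ x s, HasFDerivAt (fun y => g y s) (g' x s) x) (a b : ℝ) (x : E) :
    HasFDerivAt (fun y => ∫ s in a..b, g y s) (∫ s in a..b, g' x s) x := by
  have hgx : ∀ y, Continuous (g y) := fun y => hg.comp (continuous_const.prodMk continuous_id)
  have hgx' : Continuous (g' x) := hg'.comp (continuous_const.prodMk continuous_id)
  obtain ⟨M, hM⟩ := ((isCompact_closedBall x 1).prod
    (isCompact_uIcc (a := a) (b := b))).exists_bound_of_continuousOn hg'.continuousOn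
  refine intervalIntegral.hasFDerivAt_integral_of_dominated_of_fderiv_le (bound := fun _ => M)
    (ball_mem_nhds x one_pos) (.of_forall fun y => (hgx y).aestronglyMeasurable)
    ((hgx x).intervalIntegrable _ _) hgx'.aestronglyMeasurable ?_ (by simp) ?_
  · exact .of_forall fun s hs y hy =>
      hM (y, s) ⟨ball_subset_closedBall hy, uIoc_subset_uIcc hs⟩
  · exact .of_forall fun s _ y _ => hd y s

end Slices

section Primitive

open MeasureTheory Metric Set

variable {E : Type*} [NormedAddCommGroup E] [InnerProductSpace ℝ E] [FiniteDimensional ℝ E]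

/-- The Laplacian commutes with integration in time over a compact interval. -/
lemma contDiff_two_intervalIntegral {g : E → ℝ → ℝ}
    (hg : Continuous fun p : E × ℝ => g p.1 p.2) (hg2 : ∀ s, ContDiff ℝ 2 fun y => g y s)
    (hg' : Continuous fun p : E × ℝ => fderiv ℝ (fun y => g y p.2) p.1)
    (hg'' : Continuous fun p : E × ℝ => fderiv ℝ (fderiv ℝ fun y => g y p.2) p.1) (a b : ℝ) :
    ContDiff ℝ 2 (fun x => ∫ s in a..b, g x s) ∧
      ∀ x, Laplacian.laplacian (fun y => ∫ s in a..b, g y s) x =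
        ∫ s in a..b, Laplacian.laplacian (fun y => g y s) x := by
  have h1 := hasFDerivAt_intervalIntegral_of_continuous hg hg'
    (fun x s => ((hg2 s).differentiable (by norm_num) x).hasFDerivAt) a b
  have h2 := hasFDerivAt_intervalIntegral_of_continuous hg' hg''
    (fun x s => (((hg2 s).fderiv_right (m := 1) (by norm_num)).differentiable
      (by norm_num) x).hasFDerivAt) a b
  have e1 : fderiv ℝ (fun x => ∫ s in a..b, g x s) =
      fun x => ∫ s in a..b, fderiv ℝ (fun y => g y s) x := funext fun x => (h1 x).fderiv
  have e2 : fderiv ℝ (fderiv ℝ fun x => ∫ s in a..b, g x s) =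
      fun x => ∫ s in a..b, fderiv ℝ (fderiv ℝ fun y => g y s) x := by
    rw [e1]; exact funext fun x => (h2 x).fderiv
  refine ⟨?_, fun x => ?_⟩
  · rw [show (2 : WithTop ℕ∞) = 1 + 1 by norm_num, contDiff_succ_iff_fderiv]
    refine ⟨fun x => (h1 x).differentiableAt, by simp, ?_⟩
    rw [contDiff_one_iff_fderiv]
    refine ⟨by rw [e1]; exact fun x => (h2 x).differentiableAt, ?_⟩
    rw [e2]
    exact intervalIntegral.continuous_parametric_intervalIntegral_of_continuous' hg'' a b
  · simp only [laplacian_eq_bilinTrace, e2]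
    have h3 : Continuous fun s => fderiv ℝ (fderiv ℝ fun y => g y s) x :=
      hg''.comp (continuous_const.prodMk continuous_id)
    exact (ContinuousLinearMap.intervalIntegral_comp_comm (𝕜 := ℝ) (E := E →L[ℝ] E →L[ℝ] ℝ)
      (F := ℝ) (bilinTrace E) (Continuous.intervalIntegrable
      (E := E →L[ℝ] E →L[ℝ] ℝ) (μ := volume) h3 a b)).symm

lemma ContDiffOn.laplacian_slice {V : E × ℝ → ℝ} {I : Set ℝ} (hI : UniqueDiffOn ℝ I)
    (hV : ContDiffOn ℝ ∞ V (univ ×ˢ I)) :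
    ContDiffOn ℝ ∞ (fun p : E × ℝ => Laplacian.laplacian (fun y => V (y, p.2)) p.1)
      (univ ×ˢ I) := by
  simp only [laplacian_eq_bilinTrace]
  exact ((hV.fderiv_slice hI).fderiv_slice hI).continuousLinearMap_comp _

end Primitive

/-! ### The biharmonic heat equation -/

section Biharmonic

open MeasureTheory Set

variable {n : ℕ} {T : ℝ}

lemma IsSmoothBiharmonicHeatSolution.sub {u v : EuclideanSpace ℝ (Fin n) → ℝ → ℝ}
    (hu : IsSmoothBiharmonicHeatSolution n T u) (hv : IsSmoothBiharmonicHeatSolution n T v)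
    (hT : 0 < T) : IsSmoothBiharmonicHeatSolution n T fun x t => u x t - v x t where
  smooth := hu.smooth.sub hv.smooth
  equation := by
    intro x t ht
    have hI := uniqueDiffOn_Icc hT
    have h0 : Laplacian.laplacian (fun y => u y t - v y t) =
        Laplacian.laplacian (fun y => u y t) - Laplacian.laplacian fun y => v y t := by
      ext y
      exact ContDiffAt.laplacian_sub (hu.smooth.contDiff_two_slice ht).contDiffAt
        (hv.smooth.contDiff_two_slice ht).contDiffAt
    rw [h0, ContDiffAt.laplacian_sub
      ((hu.smooth.laplacian_slice hI).contDiff_two_slice ht).contDiffAt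
      ((hv.smooth.laplacian_slice hI).contDiff_two_slice ht).contDiffAt]
    convert! (hu.equation x t ht).sub (hv.equation x t ht) using 1
    ring

/-- The bound `|g s| ≤ √(k / s)` is integrable up to `s = 0`. -/
lemma abs_intervalIntegral_le_of_sq_le_div {g : ℝ → ℝ} {k t : ℝ} (ht : 0 ≤ t)
    (hg : ∀ s ∈ Ioc 0 t, |g s| ^ 2 ≤ k / s) : |∫ s in (0 : ℝ)..t, g s| ≤ 2 * √k * √t := by
  have hint : IntervalIntegrable (fun s : ℝ => √k * s ^ (-(1 / 2) : ℝ)) volume 0 t :=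
    (intervalIntegral.intervalIntegrable_rpow' (r := -(1 / 2)) (by norm_num)).const_mul _
  have h1 : |∫ s in (0 : ℝ)..t, g s| ≤ ∫ s in (0 : ℝ)..t, √k * s ^ (-(1 / 2) : ℝ) := by
    rw [← Real.norm_eq_abs]
    refine intervalIntegral.norm_integral_le_of_norm_le ht (.of_forall fun s hs => ?_) hint
    rw [Real.rpow_neg hs.1.le, ← Real.sqrt_eq_rpow, ← div_eq_mul_inv, ← Real.sqrt_div' _ hs.1.le]
    exact Real.le_sqrt_of_sq_le (hg s hs)
  refine h1.trans_eq ?_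
  rw [intervalIntegral.integral_const_mul, integral_rpow (Or.inl (by norm_num)),
    show (-(1 / 2) + 1 : ℝ) = 1 / 2 by norm_num, ← Real.sqrt_eq_rpow, ← Real.sqrt_eq_rpow,
    Real.sqrt_zero]
  ring

/-- A solution with zero initial data and `|Δv|² ≤ k / t` vanishes: its time primitive
`∫₀ᵗ Δv` does, and `v` is minus the Laplacian of that primitive. -/
theorem IsSmoothBiharmonicHeatSolution.eq_zero {v : EuclideanSpace ℝ (Fin n) → ℝ → ℝ} {k : ℝ}
    (hT : 0 < T) (hv : IsSmoothBiharmonicHeatSolution n T v)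
    (hk : ∀ t ∈ Ioc 0 T, ∀ x : EuclideanSpace ℝ (Fin n),
      |Laplacian.laplacian (fun y => v y t) x| ^ 2 ≤ k / t)
    (h0 : ∀ x, v x 0 = 0) : ∀ t ∈ Icc 0 T, ∀ x, v x t = 0 := by
  obtain ⟨f, hfv, hf, hf2, hf', hf''⟩ :=
    (hv.smooth.laplacian_slice (uniqueDiffOn_Icc hT)).exists_continuous_slices hT
  replace hfv : ∀ s ∈ Icc 0 T, ∀ x, f x s = Laplacian.laplacian (fun y => v y s) x := hfv
  set F : EuclideanSpace ℝ (Fin n) → ℝ → ℝ := fun x t => ∫ s in (0 : ℝ)..t, f x s with hFdef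
  have hfx : ∀ x, Continuous (f x) := fun x => hf.comp (continuous_const.prodMk continuous_id)
  have hFint := contDiff_two_intervalIntegral hf hf2 hf' hf'' 0
  have hFlap : ∀ t ∈ Icc 0 T, ∀ x, Laplacian.laplacian (fun y => F y t) x = -v x t := by
    intro t ht x
    have hcont : Continuous fun s => Laplacian.laplacian (fun y => f y s) x := by
      simp only [laplacian_eq_bilinTrace]
      exact (bilinTrace _).continuous.comp (hf''.comp (continuous_const.prodMk continuous_id))
    have hsub : Icc 0 t ⊆ Icc 0 T := Icc_subset_Icc_right ht.2
    have := intervalIntegral.integral_eq_sub_of_hasDerivAt_of_le ht.1 (f := fun s => -v x s)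
      (f' := fun s => Laplacian.laplacian (fun y => f y s) x)
      (fun s hs => ((hv.equation x s (hsub hs)).continuousWithinAt.mono hsub).neg)
      (fun s hs => by
        have hs' : s ∈ Ioo 0 T := ⟨hs.1, hs.2.trans_le ht.2⟩
        have h1 := ((hv.equation x s (Ioo_subset_Icc_self hs')).hasDerivAt
          (Icc_mem_nhds hs'.1 hs'.2)).neg
        rw [neg_neg, ← (funext (hfv s (Ioo_subset_Icc_self hs')) : (fun y => f y s) = _)] at h1
        exact h1)
      (hcont.intervalIntegrable _ _)
    rw [(hFint t).2 x, this, h0]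
    simp
  have hbound : ∀ t ∈ Icc 0 T, ∀ x, |F x t| ≤ 2 * √k * √T := by
    intro t ht x
    refine (abs_intervalIntegral_le_of_sq_le_div ht.1 fun s hs => ?_).trans
      (mul_le_mul_of_nonneg_left (Real.sqrt_le_sqrt ht.2) (by positivity))
    have hs' : s ∈ Ioc 0 T := ⟨hs.1, hs.2.trans ht.2⟩
    rw [hfv s (Ioc_subset_Icc_self hs') x]
    exact hk s hs' x
  have hF0 : ∀ t ∈ Icc 0 T, ∀ x, F x t = 0 :=
    eq_zero_of_bounded_of_laplacian_eq (f := f) (w := v)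
      (intervalIntegral.continuous_parametric_intervalIntegral_of_continuous
        (f := fun p : EuclideanSpace ℝ (Fin n) × ℝ => f p.1) (by fun_prop) continuous_snd)
      hf
      (fun x t => intervalIntegral.integral_hasDerivAt_right ((hfx x).intervalIntegrable _ _)
        ((hfx x).stronglyMeasurableAtFilter _ _) (hfx x).continuousAt)
      (fun x => by simp [hFdef]) hbound (fun t _ => (hFint t).1)
      (fun t ht => hv.smooth.contDiff_two_slice ht) hFlap
      (fun t ht x => (hfv t ht x).symm)
  intro t ht x
  have h1 := hFlap t ht x
  have h2 : (fun y => F y t) = fun _ => 0 := funext (hF0 t ht)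
  rw [h2, InnerProductSpace.laplacian_const] at h1
  simpa using h1

end Biharmonic

theorem theorem4p1 (n : ℕ) (T : ℝ) (hT : 0 < T) :
    (∀ (v : EuclideanSpace ℝ (Fin n) → ℝ → ℝ) (k₀ : ℝ),
      IsSmoothBiharmonicHeatSolution n T v →
      (∀ t ∈ Set.Ioc 0 T, ∀ x : EuclideanSpace ℝ (Fin n),
        |Laplacian.laplacian (fun y => v y t) x| ^ 2 ≤ k₀ / t) →
      (∀ x : EuclideanSpace ℝ (Fin n), v x 0 = 0) →
      ∀ t ∈ Set.Icc 0 T, ∀ x : EuclideanSpace ℝ (Fin n), v x t = 0) ∧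
    (∀ (u v : EuclideanSpace ℝ (Fin n) → ℝ → ℝ) (k₀ : ℝ),
      IsSmoothBiharmonicHeatSolution n T u →
      IsSmoothBiharmonicHeatSolution n T v →
      (∀ t ∈ Set.Ioc 0 T, ∀ x : EuclideanSpace ℝ (Fin n),
        |Laplacian.laplacian (fun y => v y t) x| ^ 2 +
          |Laplacian.laplacian (fun y => u y t) x| ^ 2 ≤ k₀ / t) →
      (∀ x : EuclideanSpace ℝ (Fin n), u x 0 = v x 0) →
      ∀ t ∈ Set.Icc 0 T, ∀ x : EuclideanSpace ℝ (Fin n), u x t = v x t) := by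
  refine ⟨fun v k₀ hv hk h0 => hv.eq_zero hT hk h0, fun u v k₀ hu hv hk h0 t ht x => ?_⟩
  refine sub_eq_zero.1 ((hu.sub hv hT).eq_zero (k := 2 * k₀) hT (fun s hs y => ?_)
    (fun y => sub_eq_zero.2 (h0 y)) t ht x)
  have hs' := Set.Ioc_subset_Icc_self hs
  have e : Laplacian.laplacian (fun z => u z s - v z s) y =
      Laplacian.laplacian (fun z => u z s) y - Laplacian.laplacian (fun z => v z s) y :=
    ContDiffAt.laplacian_sub (hu.smooth.contDiff_two_slice hs').contDiffAt
      (hv.smooth.contDiff_two_slice hs').contDiffAt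
  -- `(a - b)² ≤ 2 (a² + b²)`, whence the constant `2 * k₀`
  have hks := hk s hs y
  rw [e, sq_abs, mul_div_assoc]
  rw [sq_abs, sq_abs] at hks
  nlinarith [sq_nonneg (Laplacian.laplacian (fun z => u z s) y +
    Laplacian.laplacian (fun z => v z s) y)]
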